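/- Let $n\ge 2$ and let $\iota: M\hookrightarrow\mathbb R^{n+1}$ be a smoothly embedded hypersurface, $\dim M=n$, with the induced metric $g$ and Levi-Civita connection $\nabla$; we identify $T_xM$ with its image in $\mathbb R^{n+1}$. Let $\tilde\nabla$ be the Euclidean connection on $\mathbb R^{n+1}$. Let $v$ be a smooth vector field on $M$, let $p\in M$, and let $U\subset\mathbb R^{n+1}$ be an open neighbourhood of $p$. Extend $v$ to a smooth vector field on $U$, still denoted by $v$, and let $N$ be a smooth vector field on $U$ that along $M\cap U$ is a unit normal field to $M$. Write $\mathrm{II}(X,Y)=(\tilde\nabla_XY)^\perp$ for the second fundamental form, $h(X,Y)=\langle N,\mathrm{II}(X,Y)\rangle$ for its scalar version, $s$ for the shape operator, $g(sX,Y)=h(X,Y)$, and $H=\frac1n\operatorname{tr}s$ for the mean curvature. Suppose that $E_1,\dots,E_n$ is a smooth orthonormal frame of $M$ on $M\cap U$ consisting of principal directions, $sE_i=\kappa^iE_i$, where $\kappa^1,\dots,\kappa^n$ are the principal curvatures, and put $v^i=g(v,E_i)$ on $M\cap U$. Let $\tilde\nabla^*\tilde\nabla v=-\operatorname{div}\tilde\nabla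 v$ and $\nabla^*\nabla v=-\operatorname{div}\nabla v$ be the Bochner Laplacians on $\mathbb R^{n+1}$ and on $M$, let $\operatorname{Ric}v=(\operatorname{Ric}(v,\cdot))^\sharp$, where $\operatorname{Ric}(u,w)=\operatorname{tr}(z\mapsto R(z,u)w)$ and $R(X,Y)Z=\nabla_X\nabla_YZ-\nabla_Y\nabla_XZ-\nabla_{[X,Y]}Z$, and let $[N,v]=\tilde\nabla_Nv-\tilde\nabla_vN$ be the Lie bracket on $\mathbb R^{n+1}$. Then, at $p$, $$ \tilde\nabla^*\tilde\nabla v=\nabla^*\nabla v-\operatorname{Ric}v+nH[N,v]-\tilde\nabla_N\tilde\nabla_Nv+\tilde\nabla_{\tilde\nabla_NN}v-\sum_{i=1}^n\Big(h(E_i,\nabla_{E_i}v)+E_i(\kappa^iv^i)-h(\nabla_{E_i}E_i,v)\Big)N . $$ -/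

import Mathlib

open Bundle Manifold
open scoped ContDiff

noncomputable section

namespace Hypersurface

section Intrinsic

/-! Intrinsic Riemannian geometry of a manifold `M` modelled on `ℝⁿ`. A connection is Mathlib's
`CovariantDerivative`, and `D Y x u` is the covariant derivative `∇_u Y` at `x`. -/

variable {n : ℕ} {M : Type*} [TopologicalSpace M] [ChartedSpace (EuclideanSpace ℝ (Fin n)) M]
  [IsManifold (𝓡 n) ∞ M]
  [RiemannianBundle (fun x : M => TangentSpace (𝓡 n) x)]

/-- An orthonormal basis of the tangent space at `x`; it is only used to take metric traces. -/
def onb (x : M) : OrthonormalBasis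
    (Fin (Module.finrank ℝ (TangentSpace (𝓡 n) x))) ℝ (TangentSpace (𝓡 n) x) :=
  haveI : FiniteDimensional ℝ (TangentSpace (𝓡 n) x) :=
    inferInstanceAs (FiniteDimensional ℝ (EuclideanSpace ℝ (Fin n)))
  stdOrthonormalBasis ℝ (TangentSpace (𝓡 n) x)

/-- `D` is the Levi-Civita connection: it is torsion free and compatible with the metric. -/
def IsLeviCivita
    [IsContMDiffRiemannianBundle (𝓡 n) ∞ (EuclideanSpace ℝ (Fin n))
      (fun x : M => TangentSpace (𝓡 n) x)]
    (D : CovariantDerivative (𝓡 n) (EuclideanSpace ℝ (Fin n))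
      (fun x : M => TangentSpace (𝓡 n) x)) : Prop :=
  haveI : IsContMDiffRiemannianBundle (𝓡 n) 1 (EuclideanSpace ℝ (Fin n))
      (fun x : M => TangentSpace (𝓡 n) x) :=
    IsContMDiffRiemannianBundle.of_le (n := ∞) (by norm_cast)
  D.torsion = 0 ∧ D.IsMetricCompatible

/-- The covariant derivative of a `(1,1)`-tensor field `T`, by the Leibniz rule:
`(∇_u T)(w) = ∇_u (T W) - T (∇_u W)`, where `W` is a smooth vector field near `x` with
`W x = w`. -/
def covDerivEnd
    (D : CovariantDerivative (𝓡 n) (EuclideanSpace ℝ (Fin n))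
      (fun x : M => TangentSpace (𝓡 n) x))
    (T : Π x : M, TangentSpace (𝓡 n) x →L[ℝ] TangentSpace (𝓡 n) x)
    (x : M) (u w : TangentSpace (𝓡 n) x) : TangentSpace (𝓡 n) x :=
  D (fun y => T y (FiberBundle.extend (EuclideanSpace ℝ (Fin n)) w y)) x u
    - T x (D (FiberBundle.extend (EuclideanSpace ℝ (Fin n)) w) x u)

/-- The divergence of a `(1,1)`-tensor field: `(div T)^j = ∇^i T_i^j`. -/
def divEnd
    (D : CovariantDerivative (𝓡 n) (EuclideanSpace ℝ (Fin n))
      (fun x : M => TangentSpace (𝓡 n) x))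
    (T : Π x : M, TangentSpace (𝓡 n) x →L[ℝ] TangentSpace (𝓡 n) x)
    (x : M) : TangentSpace (𝓡 n) x :=
  ∑ i, covDerivEnd D T x (onb x i) (onb x i)

/-- The Bochner Laplacian `∇*∇ v = - div (∇ v)` of a vector field. -/
def bochner
    (D : CovariantDerivative (𝓡 n) (EuclideanSpace ℝ (Fin n))
      (fun x : M => TangentSpace (𝓡 n) x))
    (v : Π x : M, TangentSpace (𝓡 n) x) (x : M) : TangentSpace (𝓡 n) x :=
  -divEnd D (fun y => D v y) x

/-- `R(X, Y) Z = ∇_X ∇_Y Z - ∇_Y ∇_X Z - ∇_{[X, Y]} Z` for vector fields `X`, `Y`, `Z`. -/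
def curvature
    (D : CovariantDerivative (𝓡 n) (EuclideanSpace ℝ (Fin n))
      (fun x : M => TangentSpace (𝓡 n) x))
    (X Y Z : Π x : M, TangentSpace (𝓡 n) x) (x : M) : TangentSpace (𝓡 n) x :=
  D (fun y => D Z y (Y y)) x (X x) - D (fun y => D Z y (X y)) x (Y x)
    - D Z x (VectorField.mlieBracket (𝓡 n) X Y x)

/-- The Ricci tensor `Ric(u, w)`, the trace of `z ↦ R(z, u) w`; tangent vectors are extended to
smooth vector fields near `x` in order to evaluate the curvature. -/
def ricciTensor
    (D : CovariantDerivative (𝓡 n) (EuclideanSpace ℝ (Fin n))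
      (fun x : M => TangentSpace (𝓡 n) x))
    (x : M) (u w : TangentSpace (𝓡 n) x) : ℝ :=
  ∑ i, inner ℝ
    (curvature D (FiberBundle.extend (EuclideanSpace ℝ (Fin n)) (onb x i))
      (FiberBundle.extend (EuclideanSpace ℝ (Fin n)) u)
      (FiberBundle.extend (EuclideanSpace ℝ (Fin n)) w) x) (onb x i)

/-- The vector `Ric u = (Ric(u, ·))^♯`. -/
def ricci
    (D : CovariantDerivative (𝓡 n) (EuclideanSpace ℝ (Fin n))
      (fun x : M => TangentSpace (𝓡 n) x))
    (x : M) (u : TangentSpace (𝓡 n) x) : TangentSpace (𝓡 n) x :=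
  ∑ i, ricciTensor D x u (onb x i) • onb x i

end Intrinsic

section Extrinsic

/-! The geometry of a hypersurface `ι : M → ℝⁿ⁺¹`. -/

variable {n : ℕ} {M : Type*} [TopologicalSpace M] [ChartedSpace (EuclideanSpace ℝ (Fin n)) M]
  [IsManifold (𝓡 n) ∞ M]

/-- The differential `dι_x : T_x M → ℝⁿ⁺¹`. -/
def pushforward (ι : M → EuclideanSpace ℝ (Fin (n + 1))) (x : M) :
    TangentSpace (𝓡 n) x →L[ℝ] EuclideanSpace ℝ (Fin (n + 1)) :=
  mvfderiv (𝓡 n) ι x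

/-- The Euclidean covariant derivative along `M`: the directional derivative at `x`, in the
direction `u ∈ T_x M`, of the vector field `Y` on `M` regarded as an `ℝⁿ⁺¹`-valued function. -/
def ambientDeriv (ι : M → EuclideanSpace ℝ (Fin (n + 1)))
    (Y : Π x : M, TangentSpace (𝓡 n) x) (x : M) (u : TangentSpace (𝓡 n) x) :
    EuclideanSpace ℝ (Fin (n + 1)) :=
  mvfderiv (𝓡 n) (fun y => pushforward ι y (Y y)) x u

/-- The second fundamental form `II(u, w)`: the component normal to `M` of the Euclidean covariant
derivative, in the direction `u`, of a smooth vector field on `M` near `x` with value `w`. -/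
def secondFundamentalForm (ι : M → EuclideanSpace ℝ (Fin (n + 1)))
    (x : M) (u w : TangentSpace (𝓡 n) x) : EuclideanSpace ℝ (Fin (n + 1)) :=
  (pushforward ι x).rangeᗮ.starProjection
    (ambientDeriv ι (FiberBundle.extend (EuclideanSpace ℝ (Fin n)) w) x u)

/-- The scalar second fundamental form `h(u, w) = ⟨N, II(u, w)⟩`. -/
def scalarSFF (ι : M → EuclideanSpace ℝ (Fin (n + 1)))
    (N : EuclideanSpace ℝ (Fin (n + 1)) → EuclideanSpace ℝ (Fin (n + 1)))
    (x : M) (u w : TangentSpace (𝓡 n) x) : ℝ :=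
  inner ℝ (N (ι x)) (secondFundamentalForm ι x u w)

variable [RiemannianBundle (fun x : M => TangentSpace (𝓡 n) x)]

/-- The shape operator, `⟨s u, w⟩ = h(u, w)`. -/
def shapeOperator (ι : M → EuclideanSpace ℝ (Fin (n + 1)))
    (N : EuclideanSpace ℝ (Fin (n + 1)) → EuclideanSpace ℝ (Fin (n + 1)))
    (x : M) (u : TangentSpace (𝓡 n) x) : TangentSpace (𝓡 n) x :=
  ∑ i, scalarSFF ι N x u (onb x i) • onb x i

/-- The mean curvature `H = (1/n) tr h`. -/
def meanCurvature (ι : M → EuclideanSpace ℝ (Fin (n + 1)))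
    (N : EuclideanSpace ℝ (Fin (n + 1)) → EuclideanSpace ℝ (Fin (n + 1))) (x : M) : ℝ :=
  (1 / (n : ℝ)) * ∑ i, scalarSFF ι N x (onb x i) (onb x i)

end Extrinsic

section Euclidean

/-- The Euclidean connection: `(∇̃_X Y)(x)` is the derivative of `Y` at `x` in the direction
`X x`. -/
def euclNabla {m : ℕ} (X Y : EuclideanSpace ℝ (Fin m) → EuclideanSpace ℝ (Fin m)) :
    EuclideanSpace ℝ (Fin m) → EuclideanSpace ℝ (Fin m) :=
  fun x => fderiv ℝ Y x (X x)

/-- The Bochner Laplacian of `ℝᵐ`, `∇̃*∇̃ V = - div ∇̃ V = - ∑_α ∇̃_α ∇̃_α V` in the standard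
frame, which is orthonormal and parallel. -/
def euclBochner {m : ℕ} (V : EuclideanSpace ℝ (Fin m) → EuclideanSpace ℝ (Fin m)) :
    EuclideanSpace ℝ (Fin m) → EuclideanSpace ℝ (Fin m) :=
  fun x => -∑ α : Fin m, euclNabla (fun _ => EuclideanSpace.single α 1)
    (euclNabla (fun _ => EuclideanSpace.single α 1) V) x

end Euclidean

end Hypersurface

end

noncomputable section

namespace Hypersurface

open Filter Topology VectorField

/-! ### Calculus of vector-valued functions on a manifold, and the commutator identity. -/

section Calculus

variable {n : ℕ} {M : Type*} [TopologicalSpace M] [ChartedSpace (EuclideanSpace ℝ (Fin n)) M]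
  {F G : Type*} [NormedAddCommGroup F] [NormedSpace ℝ F] [NormedAddCommGroup G] [NormedSpace ℝ G]

/-! The Euclidean Laplacian is the trace of the Hessian `D²V`, computed here in the orthonormal
basis formed by `N` and the pushed-forward `E i`. The normal entry is `D²V(N,N) = ∇̃_N ∇̃_N V -
∇̃_{∇̃_N N} V`.

For the tangential entries, the Gauss formula `DV(ι_* W) = ι_*(∇_W v) + h(W,v) N` holds along `M`.
Differentiating it in a tangent direction `u` and applying Gauss again gives `D²V(ι_* u, ι_* W)` as
the intrinsic second covariant derivative of `v`, plus `h(W,v) dN(u)`, minus `h(u,W) DV(N)`, plus a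
multiple of `N` (`fderiv_fderiv_pushforward`). Its trace produces the intrinsic Bochner Laplacian
(`pushforward_bochner`) and leaves `∑ h(E_i,v) dN(E_i)` and `nH DV(N)` to be interpreted.

The traced Gauss equation (`pushforward_ricci`) reads `Ric v = -nH dN(v) + ∑ h(E_i,v) dN(E_i)`.
Substituting it turns the first leftover into `Ric v + nH dN(v)`, and the two `nH` terms combine
into `nH [N,V]`. The principal directions enter only through `h(E_i,v) = κ^i v^i` in the normal
part. -/

theorem mvfderiv_congr {f g : M → F} {x : M} (h : f =ᶠ[𝓝 x] g) :
    mvfderiv (𝓡 n) f x = mvfderiv (𝓡 n) g x := by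
  ext u
  have := h.mfderiv_eq (I := 𝓡 n) (I' := 𝓘(ℝ, F))
  simp only [mvfderiv]
  exact congr($this u)

theorem mvfderiv_eq_of_hasMFDerivAt {f : M → F} {x : M} {f' : TangentSpace (𝓡 n) x →L[ℝ] F}
    (h : HasMFDerivAt (𝓡 n) 𝓘(ℝ, F) f x f') : mvfderiv (𝓡 n) f x = f' := by
  ext u
  exact congr($(h.mfderiv) u)

theorem mvfderiv_comp_fderiv {f : M → F} {g : F → G} {x : M}
    (hg : DifferentiableAt ℝ g (f x)) (hf : MDifferentiableAt (𝓡 n) 𝓘(ℝ, F) f x)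
    (u : TangentSpace (𝓡 n) x) :
    mvfderiv (𝓡 n) (fun y => g (f y)) x u = fderiv ℝ g (f x) (mvfderiv (𝓡 n) f x u) := by
  have h := mfderiv_comp_apply x hg.mdifferentiableAt hf u
  rw [mfderiv_eq_fderiv] at h
  exact h

theorem mvfderiv_inner {H : Type*} [NormedAddCommGroup H] [InnerProductSpace ℝ H] {f g : M → H}
    {x : M} (hf : MDifferentiableAt (𝓡 n) 𝓘(ℝ, H) f x)
    (hg : MDifferentiableAt (𝓡 n) 𝓘(ℝ, H) g x) (u : TangentSpace (𝓡 n) x) :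
    mvfderiv (𝓡 n) (fun y => inner ℝ (f y) (g y)) x u =
      inner ℝ (f x) (mvfderiv (𝓡 n) g x u) + inner ℝ (mvfderiv (𝓡 n) f x u) (g x) := by
  have h := hf.hasMFDerivAt.2.inner ℝ hg.hasMFDerivAt.2
  have h1 : HasMFDerivAt (𝓡 n) 𝓘(ℝ, ℝ) (fun y => (inner ℝ (f y) (g y) : ℝ)) x _ :=
    ⟨hf.continuousAt.inner hg.continuousAt, h⟩
  rw [mvfderiv_eq_of_hasMFDerivAt h1]
  simp [writtenInExtChartAt]
  rfl

theorem mvfderiv_clm_apply {A : M → F →L[ℝ] G} {b : M → F}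
    {x : M} (hA : MDifferentiableAt (𝓡 n) 𝓘(ℝ, F →L[ℝ] G) A x)
    (hb : MDifferentiableAt (𝓡 n) 𝓘(ℝ, F) b x) (u : TangentSpace (𝓡 n) x) :
    mvfderiv (𝓡 n) (fun y => A y (b y)) x u =
      A x (mvfderiv (𝓡 n) b x u) + mvfderiv (𝓡 n) A x u (b x) := by
  have h := hA.hasMFDerivAt.2.clm_apply hb.hasMFDerivAt.2
  have h1 : HasMFDerivAt (𝓡 n) 𝓘(ℝ, G) (fun y => A y (b y)) x _ :=
    ⟨hA.continuousAt.clm_apply hb.continuousAt, h⟩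
  rw [mvfderiv_eq_of_hasMFDerivAt h1]
  simp [writtenInExtChartAt]
  rfl

variable [IsManifold (𝓡 n) ∞ M]

/-- The derivative of a vector-valued function, read in the chart at `x`. -/
theorem mvfderiv_eq_fderiv_extChartAt {f : M → F} {x y : M}
    (hy : y ∈ (chartAt (EuclideanSpace ℝ (Fin n)) x).source)
    (hf : MDifferentiableAt (𝓡 n) 𝓘(ℝ, F) f y) (u : TangentSpace (𝓡 n) y) :
    mvfderiv (𝓡 n) f y u =
      fderiv ℝ (fun z => f ((extChartAt (𝓡 n) x).symm z)) (extChartAt (𝓡 n) x y)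
        (mvfderiv (𝓡 n) (extChartAt (𝓡 n) x) y u) := by
  have hys : y ∈ (extChartAt (𝓡 n) x).source := by rwa [extChartAt_source]
  have hyt : extChartAt (𝓡 n) x y ∈ (extChartAt (𝓡 n) x).target :=
    (extChartAt (𝓡 n) x).map_source hys
  have hinv : (extChartAt (𝓡 n) x).symm (extChartAt (𝓡 n) x y) = y :=
    (extChartAt (𝓡 n) x).left_inv hys
  have h1 : MDifferentiableAt 𝓘(ℝ, EuclideanSpace ℝ (Fin n)) (𝓡 n) (extChartAt (𝓡 n) x).symm
      (extChartAt (𝓡 n) x y) := by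
    have := mdifferentiableWithinAt_extChartAt_symm (I := 𝓡 n) hyt
    simpa [mdifferentiableWithinAt_univ] using this
  have h2 : MDifferentiableAt 𝓘(ℝ, EuclideanSpace ℝ (Fin n)) 𝓘(ℝ, F)
      (fun z => f ((extChartAt (𝓡 n) x).symm z)) (extChartAt (𝓡 n) x y) := by
    have hf' : MDifferentiableAt (𝓡 n) 𝓘(ℝ, F) f
        ((extChartAt (𝓡 n) x).symm (extChartAt (𝓡 n) x y)) := by rwa [hinv]
    exact hf'.comp _ h1
  rw [← mvfderiv_comp_fderiv h2.differentiableAt (mdifferentiableAt_extChartAt hy)]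
  refine congr($(mvfderiv_congr ?_) u)
  filter_upwards [(isOpen_extChartAt_source (I := 𝓡 n) x).mem_nhds hys] with z hz
  rw [(extChartAt (𝓡 n) x).left_inv hz]

theorem contMDiffAt_mvfderiv_extChartAt {X : Π x : M, TangentSpace (𝓡 n) x} {x : M}
    (hX : ContMDiffAt (𝓡 n) (𝓡 n).tangent ∞ (fun y => (⟨y, X y⟩ : TangentBundle (𝓡 n) M)) x) :
    ContMDiffAt (𝓡 n) 𝓘(ℝ, EuclideanSpace ℝ (Fin n)) ∞
      (fun y => mvfderiv (𝓡 n) (extChartAt (𝓡 n) x) y (X y)) x := by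
  refine ((contMDiffAt_section x).1 hX).congr_of_eventuallyEq ?_
  filter_upwards [(chartAt (EuclideanSpace ℝ (Fin n)) x).open_source.mem_nhds
    (mem_chart_source _ x)] with y hy
  have := TangentBundle.continuousLinearMapAt_trivializationAt (I := 𝓡 n) hy
  have h2 := congr($this (X y))
  rw [Trivialization.continuousLinearMapAt_apply, Trivialization.linearMapAt_apply] at h2
  rw [if_pos (by simpa using hy)] at h2
  exact h2.symm

omit [IsManifold (𝓡 n) ∞ M] in
theorem contMDiffAt_fderiv_extChartAt {f : M → F} {x : M}
    (hf : ContMDiffAt (𝓡 n) 𝓘(ℝ, F) ∞ f x) :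
    ContDiffAt ℝ ∞ (fderiv ℝ (fun z => f ((extChartAt (𝓡 n) x).symm z)))
      (extChartAt (𝓡 n) x x) := by
  have h := (contMDiffAt_iff.1 hf).2
  simp only [ModelWithCorners.range_eq_univ, contDiffWithinAt_univ] at h
  exact ContDiffAt.fderiv_right h (by simp)

theorem eventually_mvfderiv_eq {f : M → F} {x : M} (hf : ContMDiffAt (𝓡 n) 𝓘(ℝ, F) ∞ f x)
    (X : Π x : M, TangentSpace (𝓡 n) x) :
    (fun y => mvfderiv (𝓡 n) f y (X y)) =ᶠ[𝓝 x]
      fun y => fderiv ℝ (fun z => f ((extChartAt (𝓡 n) x).symm z)) (extChartAt (𝓡 n) x y)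
        (mvfderiv (𝓡 n) (extChartAt (𝓡 n) x) y (X y)) := by
  have h1 := (contMDiffAt_iff_contMDiffAt_nhds (by simp)).1 (hf.of_le (m := 1) (by norm_cast))
  filter_upwards [(chartAt (EuclideanSpace ℝ (Fin n)) x).open_source.mem_nhds
    (mem_chart_source _ x), h1] with y hy h1
  exact mvfderiv_eq_fderiv_extChartAt hy (h1.mdifferentiableAt one_ne_zero) _

theorem contMDiffAt_mvfderiv_apply {f : M → F} {X : Π x : M, TangentSpace (𝓡 n) x} {x : M}
    (hf : ContMDiffAt (𝓡 n) 𝓘(ℝ, F) ∞ f x)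
    (hX : ContMDiffAt (𝓡 n) (𝓡 n).tangent ∞ (fun y => (⟨y, X y⟩ : TangentBundle (𝓡 n) M)) x) :
    ContMDiffAt (𝓡 n) 𝓘(ℝ, F) ∞ (fun y => mvfderiv (𝓡 n) f y (X y)) x := by
  refine ContMDiffAt.congr_of_eventuallyEq ?_ (eventually_mvfderiv_eq hf X)
  exact ((contMDiffAt_fderiv_extChartAt hf).comp_contMDiffAt contMDiffAt_extChartAt).clm_apply
    (contMDiffAt_mvfderiv_extChartAt hX)

/-- The bracket on `M` is defined by pulling both fields back to a chart, so its coordinates are the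
Euclidean bracket of the coordinate fields. -/
theorem mvfderiv_extChartAt_mlieBracket {X Y : Π x : M, TangentSpace (𝓡 n) x} {x : M}
    (hX : ContMDiffAt (𝓡 n) (𝓡 n).tangent ∞ (fun y => (⟨y, X y⟩ : TangentBundle (𝓡 n) M)) x)
    (hY : ContMDiffAt (𝓡 n) (𝓡 n).tangent ∞ (fun y => (⟨y, Y y⟩ : TangentBundle (𝓡 n) M)) x) :
    mvfderiv (𝓡 n) (extChartAt (𝓡 n) x) x (mlieBracket (𝓡 n) X Y x) =
      mvfderiv (𝓡 n) (fun y => mvfderiv (𝓡 n) (extChartAt (𝓡 n) x) y (Y y)) x (X x) -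
        mvfderiv (𝓡 n) (fun y => mvfderiv (𝓡 n) (extChartAt (𝓡 n) x) y (X y)) x (Y x) := by
  -- The pullback uses the inverse of the derivative of the inverse chart, which is the derivative
  -- of the chart itself.
  have key : ∀ Z : Π x : M, TangentSpace (𝓡 n) x,
      mpullbackWithin 𝓘(ℝ, EuclideanSpace ℝ (Fin n)) (𝓡 n) (extChartAt (𝓡 n) x).symm Z
        (Set.range (𝓡 n)) =ᶠ[𝓝 (extChartAt (𝓡 n) x x)]
      fun z => mvfderiv (𝓡 n) (extChartAt (𝓡 n) x) ((extChartAt (𝓡 n) x).symm z)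
        (Z ((extChartAt (𝓡 n) x).symm z)) := by
    intro Z
    filter_upwards [extChartAt_target_mem_nhds (I := 𝓡 n) x] with z hz
    rw [mpullbackWithin_apply]
    have e : (mfderivWithin 𝓘(ℝ, EuclideanSpace ℝ (Fin n)) (𝓡 n) (extChartAt (𝓡 n) x).symm
        (Set.range (𝓡 n)) z).inverse =
        mfderiv (𝓡 n) 𝓘(ℝ, EuclideanSpace ℝ (Fin n)) (extChartAt (𝓡 n) x)
          ((extChartAt (𝓡 n) x).symm z) := by
      apply ContinuousLinearMap.inverse_eq
      · exact mfderivWithin_extChartAt_symm_comp_mfderiv_extChartAt hz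
      · exact mfderiv_extChartAt_comp_mfderivWithin_extChartAt_symm hz
    rw [e]
    rfl
  have hs := mem_chart_source (EuclideanSpace ℝ (Fin n)) x
  rw [mvfderiv_eq_fderiv_extChartAt hs
      ((contMDiffAt_mvfderiv_extChartAt hX).mdifferentiableAt (by simp)) (Y x),
    mvfderiv_eq_fderiv_extChartAt hs
      ((contMDiffAt_mvfderiv_extChartAt hY).mdifferentiableAt (by simp)) (X x),
    ← mlieBracketWithin_univ, mlieBracketWithin_apply]
  have hinv : ∀ w, mvfderiv (𝓡 n) (extChartAt (𝓡 n) x) x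
      ((mfderiv (𝓡 n) 𝓘(ℝ, EuclideanSpace ℝ (Fin n)) (extChartAt (𝓡 n) x) x).inverse w) = w := by
    intro w
    exact (isInvertible_mfderiv_extChartAt (mem_extChartAt_source x)).self_apply_inverse w
  refine (hinv _).trans ?_
  simp only [ModelWithCorners.range_eq_univ, Set.preimage_univ, Set.inter_univ]
  simp only [ModelWithCorners.range_eq_univ] at key
  refine (congrFun lieBracketWithin_univ _).trans
    (((key X).lieBracket_vectorField_eq (key Y)).trans ?_)
  have hb : ∀ Z : Π x : M, TangentSpace (𝓡 n) x,
      mvfderiv (𝓡 n) (extChartAt (𝓡 n) x) ((extChartAt (𝓡 n) x).symm (extChartAt (𝓡 n) x x))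
        (Z ((extChartAt (𝓡 n) x).symm (extChartAt (𝓡 n) x x))) =
      mvfderiv (𝓡 n) (extChartAt (𝓡 n) x) x (Z x) := fun Z =>
    congrArg (fun y => mvfderiv (𝓡 n) (extChartAt (𝓡 n) x) y (Z y)) (extChartAt_to_inv x)
  simp only [lieBracket, hb]

/-- In a chart the second-order terms cancel by symmetry of the second derivative. With `f = ι` this
gives the symmetry behind the Gauss formula and that of `h`; with `f` a pushed-forward field it
expresses the flatness of Euclidean space. -/
theorem mvfderiv_mvfderiv_sub {f : M → F} {X Y : Π x : M, TangentSpace (𝓡 n) x} {x : M}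
    (hf : ContMDiffAt (𝓡 n) 𝓘(ℝ, F) ∞ f x)
    (hX : ContMDiffAt (𝓡 n) (𝓡 n).tangent ∞ (fun y => (⟨y, X y⟩ : TangentBundle (𝓡 n) M)) x)
    (hY : ContMDiffAt (𝓡 n) (𝓡 n).tangent ∞ (fun y => (⟨y, Y y⟩ : TangentBundle (𝓡 n) M)) x) :
    mvfderiv (𝓡 n) (fun y => mvfderiv (𝓡 n) f y (Y y)) x (X x) -
      mvfderiv (𝓡 n) (fun y => mvfderiv (𝓡 n) f y (X y)) x (Y x) =
      mvfderiv (𝓡 n) f x (mlieBracket (𝓡 n) X Y x) := by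
  have hs := mem_chart_source (EuclideanSpace ℝ (Fin n)) x
  have hA := contMDiffAt_fderiv_extChartAt hf
  have hA' : MDifferentiableAt (𝓡 n) 𝓘(ℝ, EuclideanSpace ℝ (Fin n) →L[ℝ] F)
      (fun y => fderiv ℝ (fun z => f ((extChartAt (𝓡 n) x).symm z)) (extChartAt (𝓡 n) x y)) x :=
    (hA.comp_contMDiffAt (contMDiffAt_extChartAt (n := ∞))).mdifferentiableAt (by simp)
  have hd := hA.differentiableAt (by simp)
  have hc := mdifferentiableAt_extChartAt (I := 𝓡 n) hs
  have hsymm : IsSymmSndFDerivAt ℝ (fun z => f ((extChartAt (𝓡 n) x).symm z))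
      (extChartAt (𝓡 n) x x) := by
    have h := (contMDiffAt_iff.1 hf).2
    simp only [ModelWithCorners.range_eq_univ, contDiffWithinAt_univ] at h
    exact ContDiffAt.isSymmSndFDerivAt h (by simp; norm_cast)
  rw [mvfderiv_congr (eventually_mvfderiv_eq hf Y), mvfderiv_congr (eventually_mvfderiv_eq hf X),
    mvfderiv_clm_apply hA' ((contMDiffAt_mvfderiv_extChartAt hY).mdifferentiableAt (by simp)),
    mvfderiv_clm_apply hA' ((contMDiffAt_mvfderiv_extChartAt hX).mdifferentiableAt (by simp)),
    mvfderiv_eq_fderiv_extChartAt hs (hf.mdifferentiableAt (by simp)),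
    mvfderiv_extChartAt_mlieBracket hX hY, mvfderiv_comp_fderiv hd hc, mvfderiv_comp_fderiv hd hc,
    hsymm.eq, map_sub]
  abel

end Calculus

/-! ### Weingarten equation and Gauss formula. -/

section Frame

variable {n : ℕ} {M : Type*} [TopologicalSpace M] [ChartedSpace (EuclideanSpace ℝ (Fin n)) M]
  [IsManifold (𝓡 n) ∞ M]

/-- The vector field `X` on `M` is smooth at `x`. -/
abbrev SmoothFieldAt (X : Π x : M, TangentSpace (𝓡 n) x) (x : M) : Prop :=
  ContMDiffAt (𝓡 n) (𝓡 n).tangent ∞ (fun y => (⟨y, X y⟩ : TangentBundle (𝓡 n) M)) x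

theorem SmoothFieldAt.mdifferentiableAt {X : Π x : M, TangentSpace (𝓡 n) x} {x : M}
    (hX : SmoothFieldAt X x) :
    MDifferentiableAt (𝓡 n) (𝓡 n).tangent (fun y => (⟨y, X y⟩ : TangentBundle (𝓡 n) M)) x :=
  ContMDiffAt.mdifferentiableAt hX (by simp)

theorem smoothFieldAt_extend {x : M} (u : TangentSpace (𝓡 n) x) :
    SmoothFieldAt (FiberBundle.extend (EuclideanSpace ℝ (Fin n)) u) x :=
  FiberBundle.contMDiffAt_extend (𝓡 n) (EuclideanSpace ℝ (Fin n)) u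

omit [IsManifold (𝓡 n) ∞ M] in
theorem contMDiffAt_inner {H : Type*} [NormedAddCommGroup H] [InnerProductSpace ℝ H] {f g : M → H}
    {x : M} (hf : ContMDiffAt (𝓡 n) 𝓘(ℝ, H) ∞ f x) (hg : ContMDiffAt (𝓡 n) 𝓘(ℝ, H) ∞ g x) :
    ContMDiffAt (𝓡 n) 𝓘(ℝ, ℝ) ∞ (fun y => (inner ℝ (f y) (g y) : ℝ)) x :=
  (contDiff_inner (𝕜 := ℝ) (E := H)).comp_contMDiffAt (hf.prodMk_space hg)

variable [RiemannianBundle (fun x : M => TangentSpace (𝓡 n) x)]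

/-- An open set `Ω` of a hypersurface `ι : M → ℝⁿ⁺¹` with the induced metric, on which the ambient
field `N` is a smooth unit normal and `E` is a smooth orthonormal tangent frame. -/
structure IsAdaptedFrame (ι : M → EuclideanSpace ℝ (Fin (n + 1)))
    (N : EuclideanSpace ℝ (Fin (n + 1)) → EuclideanSpace ℝ (Fin (n + 1)))
    (E : Fin n → Π x : M, TangentSpace (𝓡 n) x) (Ω : Set M) : Prop where
  isOpen : IsOpen Ω
  contMDiff : ContMDiff (𝓡 n) 𝓘(ℝ, EuclideanSpace ℝ (Fin (n + 1))) ∞ ι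
  metric : ∀ (x : M) (u w : TangentSpace (𝓡 n) x),
    inner ℝ u w = inner ℝ (pushforward ι x u) (pushforward ι x w)
  contMDiffAt_normal : ∀ x ∈ Ω,
    ContMDiffAt (𝓡 n) 𝓘(ℝ, EuclideanSpace ℝ (Fin (n + 1))) ∞ (fun y => N (ι y)) x
  norm_normal : ∀ x ∈ Ω, ‖N (ι x)‖ = 1
  inner_normal : ∀ x ∈ Ω, ∀ u : TangentSpace (𝓡 n) x, inner ℝ (N (ι x)) (pushforward ι x u) = 0
  smooth_frame : ∀ i, ∀ x ∈ Ω, SmoothFieldAt (E i) x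
  orthonormal : ∀ x ∈ Ω, Orthonormal ℝ (fun i => E i x)

omit [IsManifold (𝓡 n) ∞ M] in
theorem exists_orthonormalBasis_tangent {x : M} {e : Fin n → TangentSpace (𝓡 n) x}
    (he : Orthonormal ℝ e) :
    ∃ b : OrthonormalBasis (Fin n) ℝ (TangentSpace (𝓡 n) x), ∀ i, b i = e i := by
  have hfd : FiniteDimensional ℝ (TangentSpace (𝓡 n) x) :=
    inferInstanceAs (FiniteDimensional ℝ (EuclideanSpace ℝ (Fin n)))
  have hfr : Module.finrank ℝ (TangentSpace (𝓡 n) x) = n :=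
    (finrank_euclideanSpace (𝕜 := ℝ) (ι := Fin n)).trans (Fintype.card_fin n)
  refine ⟨OrthonormalBasis.mk he (he.linearIndependent.span_eq_top_of_card_eq_finrank'
    (by simp [hfr])).ge, fun i => by simp⟩

namespace IsAdaptedFrame

variable {ι : M → EuclideanSpace ℝ (Fin (n + 1))}
    {N : EuclideanSpace ℝ (Fin (n + 1)) → EuclideanSpace ℝ (Fin (n + 1))}
    {E : Fin n → Π x : M, TangentSpace (𝓡 n) x} {Ω : Set M}

theorem exists_orthonormalBasis_ambient (hF : IsAdaptedFrame ι N E Ω) {x : M} (hx : x ∈ Ω) :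
    ∃ b : OrthonormalBasis (Option (Fin n)) ℝ (EuclideanSpace ℝ (Fin (n + 1))),
      b none = N (ι x) ∧ ∀ i, b (some i) = pushforward ι x (E i x) := by
  have ho : Orthonormal ℝ (fun o : Option (Fin n) =>
      o.elim (N (ι x)) fun i => pushforward ι x (E i x)) := by
    rw [orthonormal_iff_ite]
    have h1 := orthonormal_iff_ite.1 (hF.orthonormal x hx)
    rintro (_ | i) (_ | j)
    · simp [hF.norm_normal x hx]
    · simpa using hF.inner_normal x hx _
    · simpa [real_inner_comm] using hF.inner_normal x hx (E i x)
    · simpa [hF.metric] using h1 i j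
  refine ⟨OrthonormalBasis.mk ho (ho.linearIndependent.span_eq_top_of_card_eq_finrank'
    (by simp)).ge, by simp, by simp⟩

theorem eq_zero_of_inner (hF : IsAdaptedFrame ι N E Ω) {x : M} (hx : x ∈ Ω)
    {w : EuclideanSpace ℝ (Fin (n + 1))} (hN : inner ℝ (N (ι x)) w = 0)
    (hT : ∀ u, inner ℝ (pushforward ι x u) w = 0) : w = 0 := by
  obtain ⟨b, hb, hb'⟩ := hF.exists_orthonormalBasis_ambient hx
  rw [← b.sum_repr' w]
  simp [Fintype.sum_option, hb, hb', hN, hT]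

theorem contMDiffAt_pushforward (hF : IsAdaptedFrame ι N E Ω) {Y : Π x : M, TangentSpace (𝓡 n) x}
    {x : M} (hY : SmoothFieldAt Y x) :
    ContMDiffAt (𝓡 n) 𝓘(ℝ, EuclideanSpace ℝ (Fin (n + 1))) ∞ (fun y => pushforward ι y (Y y)) x :=
  contMDiffAt_mvfderiv_apply hF.contMDiff.contMDiffAt hY

theorem inner_normal_mvfderiv (hF : IsAdaptedFrame ι N E Ω) {x : M} (hx : x ∈ Ω)
    {Y : Π x : M, TangentSpace (𝓡 n) x} (hY : SmoothFieldAt Y x) (u : TangentSpace (𝓡 n) x) :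
    inner ℝ (N (ι x)) (mvfderiv (𝓡 n) (fun y => pushforward ι y (Y y)) x u) =
      -inner ℝ (mvfderiv (𝓡 n) (fun y => N (ι y)) x u) (pushforward ι x (Y x)) := by
  have h := mvfderiv_inner ((hF.contMDiffAt_normal x hx).mdifferentiableAt (by simp))
    ((hF.contMDiffAt_pushforward hY).mdifferentiableAt (by simp)) u
  have h0 : (fun y => (inner ℝ (N (ι y)) (pushforward ι y (Y y)) : ℝ)) =ᶠ[𝓝 x] fun _ => 0 := by
    filter_upwards [hF.isOpen.mem_nhds hx] with y hy using hF.inner_normal y hy _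
  rw [mvfderiv_congr h0, mvfderiv_const] at h
  simp only [zero_apply] at h
  linarith

/-- The Weingarten equation, from differentiating `⟨N, ι_* Y⟩ = 0`. It frees `h` from the extension
chosen in its definition, making bilinearity and smoothness evident. -/
theorem scalarSFF_eq (hF : IsAdaptedFrame ι N E Ω) {x : M} (hx : x ∈ Ω)
    (u w : TangentSpace (𝓡 n) x) :
    scalarSFF ι N x u w =
      -inner ℝ (mvfderiv (𝓡 n) (fun y => N (ι y)) x u) (pushforward ι x w) := by
  have hmem : N (ι x) ∈ (pushforward ι x).rangeᗮ := by
    rw [Submodule.mem_orthogonal]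
    rintro _ ⟨z, rfl⟩
    rw [real_inner_comm]
    exact hF.inner_normal x hx z
  have h := hF.inner_normal_mvfderiv hx (smoothFieldAt_extend w) u
  rw [FiberBundle.extend_apply_self] at h
  rw [← h, scalarSFF, secondFundamentalForm, ← Submodule.inner_starProjection_left_eq_right,
    Submodule.starProjection_eq_self_iff.2 hmem]
  rfl

theorem inner_mvfderiv_normal (hF : IsAdaptedFrame ι N E Ω) {x : M} (hx : x ∈ Ω)
    (u : TangentSpace (𝓡 n) x) :
    inner ℝ (N (ι x)) (mvfderiv (𝓡 n) (fun y => N (ι y)) x u) = 0 := by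
  have hd := (hF.contMDiffAt_normal x hx).mdifferentiableAt (by simp)
  have h := mvfderiv_inner hd hd u
  have h0 : (fun y => (inner ℝ (N (ι y)) (N (ι y)) : ℝ)) =ᶠ[𝓝 x] fun _ => 1 := by
    filter_upwards [hF.isOpen.mem_nhds hx] with y hy
    rw [real_inner_self_eq_norm_sq, hF.norm_normal y hy, one_pow]
  rw [mvfderiv_congr h0, mvfderiv_const] at h
  simp only [zero_apply] at h
  rw [real_inner_comm (N (ι x))] at h
  linarith

theorem contMDiffAt_scalarSFF (hF : IsAdaptedFrame ι N E Ω) {x : M} (hx : x ∈ Ω)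
    {X Y : Π x : M, TangentSpace (𝓡 n) x} (hX : SmoothFieldAt X x) (hY : SmoothFieldAt Y x) :
    ContMDiffAt (𝓡 n) 𝓘(ℝ, ℝ) ∞ (fun y => scalarSFF ι N y (X y) (Y y)) x := by
  have h := (contMDiffAt_inner (contMDiffAt_mvfderiv_apply (hF.contMDiffAt_normal x hx) hX)
    (hF.contMDiffAt_pushforward hY)).neg
  refine h.congr_of_eventuallyEq ?_
  filter_upwards [hF.isOpen.mem_nhds hx] with y hy using hF.scalarSFF_eq hy _ _

variable [IsContMDiffRiemannianBundle (𝓡 n) ∞ (EuclideanSpace ℝ (Fin n))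
      (fun x : M => TangentSpace (𝓡 n) x)]
  {D : CovariantDerivative (𝓡 n) (EuclideanSpace ℝ (Fin n)) (fun x : M => TangentSpace (𝓡 n) x)}

/-- The Gauss formula: the Levi-Civita connection is the tangential part of the ambient
derivative. -/
theorem mvfderiv_pushforward (hF : IsAdaptedFrame ι N E Ω) (hD : IsLeviCivita D) {x : M}
    (hx : x ∈ Ω) {Y : Π x : M, TangentSpace (𝓡 n) x} (hY : SmoothFieldAt Y x)
    (u : TangentSpace (𝓡 n) x) :
    mvfderiv (𝓡 n) (fun y => pushforward ι y (Y y)) x u =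
      pushforward ι x (D Y x u) + scalarSFF ι N x u (Y x) • N (ι x) := by
  have hR : IsContMDiffRiemannianBundle (𝓡 n) 1 (EuclideanSpace ℝ (Fin n))
      (fun x : M => TangentSpace (𝓡 n) x) :=
    IsContMDiffRiemannianBundle.of_le (n := ∞) (by norm_cast)
  -- The tangential difference between the ambient derivative and `D`. It is symmetric in `X, Y`
  -- because both are torsion free, and skew in `Y, Z` because both are metric; together these force
  -- it to vanish, as in the uniqueness of the Levi-Civita connection.
  let c : (Π x : M, TangentSpace (𝓡 n) x) → (Π x : M, TangentSpace (𝓡 n) x) →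
      (Π x : M, TangentSpace (𝓡 n) x) → ℝ := fun X Y Z =>
    inner ℝ (pushforward ι x (Z x)) (mvfderiv (𝓡 n) (fun y => pushforward ι y (Y y)) x (X x) -
      pushforward ι x (D Y x (X x)))
  have hsymm : ∀ {X Y} Z, SmoothFieldAt X x → SmoothFieldAt Y x → c X Y Z = c Y X Z := by
    intro X Y Z hX hY
    have h1 := mvfderiv_mvfderiv_sub (f := ι) hF.contMDiff.contMDiffAt hX hY
    have h2 := congr(pushforward ι x $(D.torsion_eq_zero_iff.1 hD.1 hX.mdifferentiableAt hY.mdifferentiableAt))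
    rw [map_sub] at h2
    simp only [c]
    congr 1
    have h3 := h2.trans h1.symm
    rw [sub_eq_sub_iff_add_eq_add] at h3 ⊢
    exact h3.symm.trans (add_comm _ _)
  have hskew : ∀ X {Y Z}, SmoothFieldAt Y x → SmoothFieldAt Z x → c X Y Z = -c X Z Y := by
    intro X Y Z hY hZ
    have h1 := mvfderiv_inner ((hF.contMDiffAt_pushforward hY).mdifferentiableAt (by simp))
      ((hF.contMDiffAt_pushforward hZ).mdifferentiableAt (by simp)) (X x)
    have h2 := hD.2.mvfderiv_inner_eq X hY.mdifferentiableAt hZ.mdifferentiableAt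
    simp only [hF.metric] at h2
    simp only [c, inner_sub_right]
    have h3 := h1.symm.trans h2
    have h4 := real_inner_comm (pushforward ι x (Z x))
      (mvfderiv (𝓡 n) (fun y => pushforward ι y (Y y)) x (X x))
    have h5 := real_inner_comm (pushforward ι x (Z x)) (pushforward ι x (D Y x (X x)))
    linarith
  rw [← sub_eq_zero]
  refine hF.eq_zero_of_inner hx ?_ fun w => ?_
  · rw [inner_sub_right, inner_add_right, hF.inner_normal x hx, inner_smul_right,
      real_inner_self_eq_norm_sq, hF.norm_normal x hx, hF.inner_normal_mvfderiv hx hY,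
      hF.scalarSFF_eq hx]
    ring
  · have hX := smoothFieldAt_extend u
    have hZ := smoothFieldAt_extend w
    set X := FiberBundle.extend (EuclideanSpace ℝ (Fin n)) u
    set Z := FiberBundle.extend (EuclideanSpace ℝ (Fin n)) w
    have hXx : X x = u := FiberBundle.extend_apply_self _ u
    have hZx : Z x = w := FiberBundle.extend_apply_self _ w
    have h0 : c X Y Z = 0 := by
      have h1 := hskew X hY hZ
      have h2 := hsymm Y hX hZ
      have h3 := hskew Z hX hY
      have h4 := hsymm X hZ hY
      have h5 := hskew Y hZ hX
      have h6 := hsymm Z hY hX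
      linarith
    simp only [c, hXx, hZx] at h0
    rw [← sub_sub, inner_sub_right, h0, inner_smul_right, real_inner_comm,
      hF.inner_normal x hx, mul_zero, sub_zero]

theorem inner_pushforward_covDeriv (hF : IsAdaptedFrame ι N E Ω) (hD : IsLeviCivita D) {x : M}
    (hx : x ∈ Ω) {Y : Π x : M, TangentSpace (𝓡 n) x} (hY : SmoothFieldAt Y x)
    (u w : TangentSpace (𝓡 n) x) :
    inner ℝ (D Y x u) w =
      (inner ℝ (mvfderiv (𝓡 n) (fun y => pushforward ι y (Y y)) x u) (pushforward ι x w) : ℝ) := by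
  rw [hF.mvfderiv_pushforward hD hx hY, inner_add_left, inner_smul_left, hF.inner_normal x hx,
    hF.metric]
  simp

/-- By the Gauss formula, the coefficients of `∇_X Y` in the frame `E` are inner products of smooth
ambient-valued functions. -/
theorem smoothFieldAt_covDeriv (hF : IsAdaptedFrame ι N E Ω) (hD : IsLeviCivita D)
    {X Y : Π x : M, TangentSpace (𝓡 n) x} (hY : ∀ x ∈ Ω, SmoothFieldAt Y x) {x : M}
    (hx : x ∈ Ω) (hX : SmoothFieldAt X x) :
    SmoothFieldAt (fun y => D Y y (X y)) x := by
  have h : SmoothFieldAt (fun y => ∑ j, (inner ℝ (mvfderiv (𝓡 n)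
      (fun y => pushforward ι y (Y y)) y (X y)) (pushforward ι y (E j y)) : ℝ) • E j y) x := by
    refine ContMDiffAt.sum_section fun j _ => ContMDiffAt.smul_section ?_ (hF.smooth_frame j x hx)
    exact contMDiffAt_inner (contMDiffAt_mvfderiv_apply (hF.contMDiffAt_pushforward (hY x hx)) hX)
      (hF.contMDiffAt_pushforward (hF.smooth_frame j x hx))
  refine ContMDiffAt.congr_of_eventuallyEq h ?_
  filter_upwards [hF.isOpen.mem_nhds hx] with y hy
  obtain ⟨b, hb⟩ := exists_orthonormalBasis_tangent (hF.orthonormal y hy)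
  congr 1
  rw [← b.sum_repr' (D Y y (X y))]
  refine Finset.sum_congr rfl fun j _ => ?_
  rw [hb, ← hF.inner_pushforward_covDeriv hD hy (hY y hy), real_inner_comm]

end IsAdaptedFrame

end Frame

/-! ### Basis independence of traces. -/

section Trace

variable {H G ι₁ ι₂ : Type*} [NormedAddCommGroup H] [InnerProductSpace ℝ H]
  [AddCommGroup G] [Module ℝ G] [Fintype ι₁] [Fintype ι₂]

/-- The metric trace of a bilinear map does not depend on the orthonormal basis. -/
theorem sum_orthonormalBasis_eq (b : OrthonormalBasis ι₁ ℝ H) (c : OrthonormalBasis ι₂ ℝ H)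
    (B : H →ₗ[ℝ] H →ₗ[ℝ] G) : ∑ i, B (b i) (b i) = ∑ j, B (c j) (c j) := by
  have : FiniteDimensional ℝ H := b.toBasis.finiteDimensional_of_finite
  -- Both traces are the image of the same canonical tensor `∑ e_i ⊗ e_i`.
  have h := (InnerProductSpace.canonicalCovariantTensor_eq_sum H b).symm.trans
    (InnerProductSpace.canonicalCovariantTensor_eq_sum H c)
  simpa using congrArg (TensorProduct.lift B) h

end Trace

section Bundle

variable {n : ℕ} {M : Type*} [TopologicalSpace M] [ChartedSpace (EuclideanSpace ℝ (Fin n)) M]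
  [IsManifold (𝓡 n) ∞ M]

/-- The extension is constant in the trivialization at `p`, hence smooth on its whole base set.
Second covariant derivatives at `p` need smoothness on a neighbourhood, not only at `p`. -/
theorem smoothFieldAt_extend_of_mem {p x : M}
    (hx : x ∈ (trivializationAt (EuclideanSpace ℝ (Fin n)) (TangentSpace (𝓡 n) : M → Type _)
      p).baseSet) (u : TangentSpace (𝓡 n) p) :
    SmoothFieldAt (FiberBundle.extend (EuclideanSpace ℝ (Fin n)) u) x := by
  set t := trivializationAt (EuclideanSpace ℝ (Fin n)) (TangentSpace (𝓡 n) : M → Type _) p with ht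
  refine (t.contMDiffAt_section_iff hx).2 ?_
  refine (contMDiffAt_const (c := (t ⟨p, u⟩).2)).congr_of_eventuallyEq ?_
  filter_upwards [t.open_baseSet.mem_nhds hx] with y hy
  simp [FiberBundle.extend, ← ht, hy]

end Bundle

/-! ### Gauss equation and the ambient Hessian along the hypersurface. -/

namespace IsAdaptedFrame

variable {n : ℕ} {M : Type*} [TopologicalSpace M] [ChartedSpace (EuclideanSpace ℝ (Fin n)) M]
  [IsManifold (𝓡 n) ∞ M] [RiemannianBundle (fun x : M => TangentSpace (𝓡 n) x)]
  {ι : M → EuclideanSpace ℝ (Fin (n + 1))}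
  {N : EuclideanSpace ℝ (Fin (n + 1)) → EuclideanSpace ℝ (Fin (n + 1))}
  {E : Fin n → Π x : M, TangentSpace (𝓡 n) x} {Ω : Set M}

/-- The two ambient derivatives differ by `ι_* [X,Y]`, which is orthogonal to `N`. -/
theorem scalarSFF_comm (hF : IsAdaptedFrame ι N E Ω) {x : M} (hx : x ∈ Ω)
    (u w : TangentSpace (𝓡 n) x) : scalarSFF ι N x u w = scalarSFF ι N x w u := by
  have hX := smoothFieldAt_extend u
  have hY := smoothFieldAt_extend w
  have h := mvfderiv_mvfderiv_sub (f := ι) hF.contMDiff.contMDiffAt hX hY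
  have h1 := hF.inner_normal_mvfderiv hx hY u
  have h2 := hF.inner_normal_mvfderiv hx hX w
  rw [FiberBundle.extend_apply_self, FiberBundle.extend_apply_self] at h
  rw [FiberBundle.extend_apply_self] at h1 h2
  rw [hF.scalarSFF_eq hx, hF.scalarSFF_eq hx, ← h1, ← h2, ← sub_eq_zero, ← inner_sub_right]
  exact congr(inner ℝ (N (ι x)) $h).trans (hF.inner_normal x hx _)

/-- A vector tangent to the hypersurface is the image of its expansion in an orthonormal basis. -/
theorem sum_scalarSFF_smul (hF : IsAdaptedFrame ι N E Ω) {x : M} (hx : x ∈ Ω) {I : Type*}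
    [Fintype I] (b : OrthonormalBasis I ℝ (TangentSpace (𝓡 n) x)) (u : TangentSpace (𝓡 n) x) :
    ∑ i, scalarSFF ι N x u (b i) • pushforward ι x (b i) =
      -mvfderiv (𝓡 n) (fun y => N (ι y)) x u := by
  rw [← sub_eq_zero]
  refine hF.eq_zero_of_inner hx ?_ fun w => ?_
  · rw [sub_neg_eq_add, inner_add_right, inner_sum]
    simp [inner_smul_right, hF.inner_normal x hx, hF.inner_mvfderiv_normal hx]
  · simp only [inner_sub_right, inner_sum, inner_smul_right, ← hF.metric, inner_neg_right]
    conv_lhs =>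
      enter [2, 1]
      rw [real_inner_comm, ← b.sum_repr' w]
    simp only [map_sum, map_smul, inner_sum, inner_smul_right, hF.scalarSFF_eq hx]
    rw [sub_neg_eq_add, ← Finset.sum_add_distrib]
    refine Finset.sum_eq_zero fun i _ => ?_
    rw [real_inner_comm (b i) w]
    ring

variable [IsContMDiffRiemannianBundle (𝓡 n) ∞ (EuclideanSpace ℝ (Fin n))
      (fun x : M => TangentSpace (𝓡 n) x)]
  {D : CovariantDerivative (𝓡 n) (EuclideanSpace ℝ (Fin n)) (fun x : M => TangentSpace (𝓡 n) x)}

/-- Differentiating the normal term `h(Y,Z) N` of the Gauss formula contributes the tangential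
vector `h(Y,Z) dN(X)`, which Weingarten turns into the product of second fundamental forms. -/
theorem inner_covDeriv_covDeriv (hF : IsAdaptedFrame ι N E Ω) (hD : IsLeviCivita D)
    {X Y Z : Π x : M, TangentSpace (𝓡 n) x} {x : M} (hx : x ∈ Ω)
    (hY : SmoothFieldAt Y x) (hZ : ∀ y ∈ Ω, SmoothFieldAt Z y) (w : TangentSpace (𝓡 n) x) :
    inner ℝ (D (fun y => D Z y (Y y)) x (X x)) w =
      (inner ℝ (mvfderiv (𝓡 n) (fun y => mvfderiv (𝓡 n) (fun z => pushforward ι z (Z z)) y (Y y))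
        x (X x)) (pushforward ι x w) : ℝ) +
      scalarSFF ι N x (Y x) (Z x) * scalarSFF ι N x (X x) w := by
  rw [hF.inner_pushforward_covDeriv hD hx (hF.smoothFieldAt_covDeriv hD hZ hx hY)]
  have h : (fun y => pushforward ι y (D Z y (Y y))) =ᶠ[𝓝 x]
      fun y => mvfderiv (𝓡 n) (fun z => pushforward ι z (Z z)) y (Y y) -
        scalarSFF ι N y (Y y) (Z y) • N (ι y) := by
    filter_upwards [hF.isOpen.mem_nhds hx] with y hy
    rw [hF.mvfderiv_pushforward hD hy (hZ y hy), add_sub_cancel_right]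
  have d1 := (contMDiffAt_mvfderiv_apply (hF.contMDiffAt_pushforward (hZ x hx)) hY
    ).mdifferentiableAt (by simp)
  have d2 := (hF.contMDiffAt_scalarSFF hx hY (hZ x hx)).mdifferentiableAt (by simp)
  have d3 := (hF.contMDiffAt_normal x hx).mdifferentiableAt (by simp)
  have d4 : MDifferentiableAt (𝓡 n) 𝓘(ℝ, EuclideanSpace ℝ (Fin (n + 1)))
      (fun y => scalarSFF ι N y (Y y) (Z y) • N (ι y)) x := d2.smul d3
  rw [mvfderiv_congr h, mvfderiv_fun_sub d1 d4, mvfderiv_fun_smul d2 d3]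
  simp only [sub_apply, add_apply, smul_apply,
    ContinuousLinearMap.smulRight_apply, inner_sub_left, inner_add_left, real_inner_smul_left,
    hF.inner_normal x hx, hF.scalarSFF_eq hx (X x)]
  ring

/-- The Gauss equation. -/
theorem inner_curvature (hF : IsAdaptedFrame ι N E Ω) (hD : IsLeviCivita D)
    {X Y Z : Π x : M, TangentSpace (𝓡 n) x} {x : M} (hx : x ∈ Ω)
    (hX : SmoothFieldAt X x) (hY : SmoothFieldAt Y x) (hZ : ∀ y ∈ Ω, SmoothFieldAt Z y)
    (w : TangentSpace (𝓡 n) x) :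
    inner ℝ (curvature D X Y Z x) w =
      scalarSFF ι N x (Y x) (Z x) * scalarSFF ι N x (X x) w -
        scalarSFF ι N x (X x) (Z x) * scalarSFF ι N x (Y x) w := by
  have h := mvfderiv_mvfderiv_sub (hF.contMDiffAt_pushforward (hZ x hx)) hX hY
  rw [curvature, inner_sub_left, inner_sub_left, hF.inner_covDeriv_covDeriv hD hx hY hZ,
    hF.inner_covDeriv_covDeriv hD hx hX hZ, hF.inner_pushforward_covDeriv hD hx (hZ x hx), ← h,
    inner_sub_left]
  ring

theorem fderiv_pushforward (hF : IsAdaptedFrame ι N E Ω) (hD : IsLeviCivita D)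
    {V : EuclideanSpace ℝ (Fin (n + 1)) → EuclideanSpace ℝ (Fin (n + 1))}
    {v : Π x : M, TangentSpace (𝓡 n) x} (hV : ∀ x ∈ Ω, ContDiffAt ℝ ∞ V (ι x))
    (hVv : ∀ x ∈ Ω, V (ι x) = pushforward ι x (v x)) (hv : ∀ x ∈ Ω, SmoothFieldAt v x)
    {x : M} (hx : x ∈ Ω) (u : TangentSpace (𝓡 n) x) :
    fderiv ℝ V (ι x) (pushforward ι x u) =
      pushforward ι x (D v x u) + scalarSFF ι N x u (v x) • N (ι x) := by
  rw [← hF.mvfderiv_pushforward hD hx (hv x hx)]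
  have h : (fun y => pushforward ι y (v y)) =ᶠ[𝓝 x] fun y => V (ι y) := by
    filter_upwards [hF.isOpen.mem_nhds hx] with y hy using (hVv y hy).symm
  rw [mvfderiv_congr h, mvfderiv_comp_fderiv ((hV x hx).differentiableAt (by simp))
    (hF.contMDiff.mdifferentiableAt (by simp))]
  rfl

/-- The ambient Hessian of an extension `V` of a tangent field `v`, on tangent vectors, in terms of
the intrinsic second covariant derivative and the second fundamental form. -/
theorem fderiv_fderiv_pushforward (hF : IsAdaptedFrame ι N E Ω) (hD : IsLeviCivita D)
    {V : EuclideanSpace ℝ (Fin (n + 1)) → EuclideanSpace ℝ (Fin (n + 1))}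
    {v : Π x : M, TangentSpace (𝓡 n) x} (hV : ∀ x ∈ Ω, ContDiffAt ℝ ∞ V (ι x))
    (hVv : ∀ x ∈ Ω, V (ι x) = pushforward ι x (v x)) (hv : ∀ x ∈ Ω, SmoothFieldAt v x)
    {W : Π x : M, TangentSpace (𝓡 n) x} (hW : ∀ x ∈ Ω, SmoothFieldAt W x)
    {x : M} (hx : x ∈ Ω) (u : TangentSpace (𝓡 n) x) :
    fderiv ℝ (fderiv ℝ V) (ι x) (pushforward ι x u) (pushforward ι x (W x)) =
      pushforward ι x (D (fun y => D v y (W y)) x u - D v x (D W x u))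
      + scalarSFF ι N x (W x) (v x) • mvfderiv (𝓡 n) (fun y => N (ι y)) x u
      - scalarSFF ι N x u (W x) • fderiv ℝ V (ι x) (N (ι x))
      + (scalarSFF ι N x u (D v x (W x))
          + mvfderiv (𝓡 n) (fun y => scalarSFF ι N y (W y) (v y)) x u
          - scalarSFF ι N x (D W x u) (v x)) • N (ι x) := by
  have hV' : ContDiffAt ℝ ∞ (fderiv ℝ V) (ι x) := (hV x hx).fderiv_right (by simp)
  have hι : MDifferentiableAt (𝓡 n) 𝓘(ℝ, EuclideanSpace ℝ (Fin (n + 1))) ι x :=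
    hF.contMDiff.mdifferentiableAt (by simp)
  have dA : MDifferentiableAt (𝓡 n)
      𝓘(ℝ, EuclideanSpace ℝ (Fin (n + 1)) →L[ℝ] EuclideanSpace ℝ (Fin (n + 1)))
      (fun y => fderiv ℝ V (ι y)) x :=
    (hV'.comp_contMDiffAt hF.contMDiff.contMDiffAt).mdifferentiableAt (by simp)
  have dW := (hF.contMDiffAt_pushforward (hW x hx)).mdifferentiableAt (by simp)
  have hDW := hF.smoothFieldAt_covDeriv hD hv hx (hW x hx)
  have d1 := (hF.contMDiffAt_pushforward hDW).mdifferentiableAt (by simp)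
  have d2 := (hF.contMDiffAt_scalarSFF hx (hW x hx) (hv x hx)).mdifferentiableAt (by simp)
  have d3 := (hF.contMDiffAt_normal x hx).mdifferentiableAt (by simp)
  have d4 : MDifferentiableAt (𝓡 n) 𝓘(ℝ, EuclideanSpace ℝ (Fin (n + 1)))
      (fun y => scalarSFF ι N y (W y) (v y) • N (ι y)) x := d2.smul d3
  -- The Gauss formula for `v` as an identity of functions near `x`; its derivative along `u` is
  -- then solved for the Hessian term.
  have h : (fun y => fderiv ℝ V (ι y) (pushforward ι y (W y))) =ᶠ[𝓝 x]
      fun y => pushforward ι y (D v y (W y)) + scalarSFF ι N y (W y) (v y) • N (ι y) := by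
    filter_upwards [hF.isOpen.mem_nhds hx] with y hy
    exact hF.fderiv_pushforward hD hV hVv hv hy _
  have h1 := congr($(mvfderiv_congr h) u)
  rw [mvfderiv_clm_apply dA dW, mvfderiv_fun_add d1 d4, mvfderiv_fun_smul d2 d3,
    mvfderiv_comp_fderiv (hV'.differentiableAt (by simp)) hι, hF.mvfderiv_pushforward hD hx
    (hW x hx), map_add, map_smul, hF.fderiv_pushforward hD hV hVv hv hx] at h1
  simp only [add_apply, smul_apply,
    ContinuousLinearMap.smulRight_apply] at h1
  rw [hF.mvfderiv_pushforward hD hx hDW] at h1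
  have h2 : fderiv ℝ (fderiv ℝ V) (ι x) (pushforward ι x u) (pushforward ι x (W x)) =
    _ - (pushforward ι x (D v x (D W x u)) + scalarSFF ι N x (D W x u) (v x) • N (ι x) +
      scalarSFF ι N x u (W x) • fderiv ℝ V (ι x) (N (ι x))) := eq_sub_of_add_eq' h1
  rw [h2, map_sub]
  module

end IsAdaptedFrame

/-! ### Traces: mean curvature, Ricci and Bochner Laplacian. -/

namespace IsAdaptedFrame

variable {n : ℕ} {M : Type*} [TopologicalSpace M] [ChartedSpace (EuclideanSpace ℝ (Fin n)) M]
  [IsManifold (𝓡 n) ∞ M] [RiemannianBundle (fun x : M => TangentSpace (𝓡 n) x)]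
  {ι : M → EuclideanSpace ℝ (Fin (n + 1))}
  {N : EuclideanSpace ℝ (Fin (n + 1)) → EuclideanSpace ℝ (Fin (n + 1))}
  {E : Fin n → Π x : M, TangentSpace (𝓡 n) x} {Ω : Set M}

theorem sum_scalarSFF_onb (hF : IsAdaptedFrame ι N E Ω) {x : M} (hx : x ∈ Ω) :
    ∑ k, scalarSFF ι N x (onb x k) (onb x k) = ∑ i, scalarSFF ι N x (E i x) (E i x) := by
  obtain ⟨b, hb⟩ := exists_orthonormalBasis_tangent (hF.orthonormal x hx)
  have h := sum_orthonormalBasis_eq (onb x) b (LinearMap.mk₂ ℝ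
    (fun u w => scalarSFF ι N x u w)
    (fun u u' w => by simp only [hF.scalarSFF_eq hx, map_add, inner_add_left]; ring)
    (fun a u w => by
      simp only [hF.scalarSFF_eq hx, map_smul, real_inner_smul_left, smul_eq_mul]; ring)
    (fun u w w' => by simp only [hF.scalarSFF_eq hx, map_add, inner_add_right]; ring)
    (fun a u w => by
      simp only [hF.scalarSFF_eq hx, map_smul, real_inner_smul_right, smul_eq_mul]; ring))
  simpa only [LinearMap.mk₂_apply, hb] using h

theorem inner_shapeOperator (hF : IsAdaptedFrame ι N E Ω) {x : M} (hx : x ∈ Ω)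
    (u w : TangentSpace (𝓡 n) x) :
    inner ℝ (shapeOperator ι N x u) w = scalarSFF ι N x u w := by
  have h := congr(inner ℝ $(hF.sum_scalarSFF_smul hx (onb x) u) (pushforward ι x w))
  rw [inner_neg_left, ← hF.scalarSFF_eq hx] at h
  rw [← h, hF.metric, shapeOperator, map_sum]
  simp only [map_smul]

variable [IsContMDiffRiemannianBundle (𝓡 n) ∞ (EuclideanSpace ℝ (Fin n))
      (fun x : M => TangentSpace (𝓡 n) x)]
  {D : CovariantDerivative (𝓡 n) (EuclideanSpace ℝ (Fin n)) (fun x : M => TangentSpace (𝓡 n) x)}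

/-- The Ricci curvature of a hypersurface of Euclidean space. -/
theorem pushforward_ricci (hF : IsAdaptedFrame ι N E Ω) (hD : IsLeviCivita D) {p : M}
    (hp : p ∈ Ω) (hΩ : Ω ⊆ (trivializationAt (EuclideanSpace ℝ (Fin n))
      (TangentSpace (𝓡 n) : M → Type _) p).baseSet) (u : TangentSpace (𝓡 n) p) :
    pushforward ι p (ricci D p u) =
      -(∑ i, scalarSFF ι N p (E i p) (E i p)) • mvfderiv (𝓡 n) (fun y => N (ι y)) p u
      + ∑ i, scalarSFF ι N p (E i p) u • mvfderiv (𝓡 n) (fun y => N (ι y)) p (E i p) := by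
  obtain ⟨b, hb⟩ := exists_orthonormalBasis_tangent (hF.orthonormal p hp)
  -- The Ricci tensor is traced over `onb`, while the result is stated in the frame `E`.
  have htr := sum_orthonormalBasis_eq (onb p) b (LinearMap.mk₂ ℝ
    (fun z w => scalarSFF ι N p z u • mvfderiv (𝓡 n) (fun y => N (ι y)) p w)
    (fun z z' w => by
      simp only [hF.scalarSFF_eq hp, map_add, inner_add_left, neg_add, add_smul])
    (fun a z w => by
      simp only [hF.scalarSFF_eq hp, map_smul, real_inner_smul_left, smul_smul, mul_neg])
    (fun z w w' => by simp only [map_add, smul_add])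
    (fun a z w => by simp only [map_smul, smul_comm a]))
  simp only [LinearMap.mk₂_apply, hb] at htr
  have hric : ∀ w, ricciTensor D p u w =
      (∑ k, scalarSFF ι N p (onb p k) (onb p k)) * scalarSFF ι N p u w -
        ∑ k, scalarSFF ι N p (onb p k) w * scalarSFF ι N p u (onb p k) := by
    intro w
    rw [ricciTensor, Finset.sum_mul, ← Finset.sum_sub_distrib]
    refine Finset.sum_congr rfl fun k _ => ?_
    rw [hF.inner_curvature hD hp (smoothFieldAt_extend _) (smoothFieldAt_extend _)
      (fun y hy => smoothFieldAt_extend_of_mem (hΩ hy) w)]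
    simp only [FiberBundle.extend_apply_self]
    ring
  have hs := hF.sum_scalarSFF_smul hp (onb p)
  have h1 : ∑ j, (∑ k, scalarSFF ι N p (onb p k) (onb p j) * scalarSFF ι N p u (onb p k)) •
      pushforward ι p (onb p j) =
      -∑ k, scalarSFF ι N p (onb p k) u • mvfderiv (𝓡 n) (fun y => N (ι y)) p (onb p k) := by
    simp only [Finset.sum_smul]
    rw [Finset.sum_comm, ← Finset.sum_neg_distrib]
    refine Finset.sum_congr rfl fun k _ => ?_
    rw [← smul_neg, ← hs, Finset.smul_sum, hF.scalarSFF_comm hp u]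
    refine Finset.sum_congr rfl fun j _ => ?_
    rw [smul_smul, mul_comm]
  have h2 : pushforward ι p (ricci D p u) =
      ∑ j, ricciTensor D p u (onb p j) • pushforward ι p (onb p j) := by
    rw [ricci, map_sum]
    simp only [map_smul]
  rw [h2, ← htr, ← hF.sum_scalarSFF_onb hp]
  simp only [hric, sub_smul, Finset.sum_sub_distrib, mul_smul]
  rw [h1, ← Finset.smul_sum, hs]
  module

/-- The Bochner Laplacian of a hypersurface, in terms of the Hessian of an ambient extension. -/
theorem pushforward_bochner (hF : IsAdaptedFrame ι N E Ω) (hD : IsLeviCivita D)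
    {V : EuclideanSpace ℝ (Fin (n + 1)) → EuclideanSpace ℝ (Fin (n + 1))}
    {v : Π x : M, TangentSpace (𝓡 n) x} (hV : ∀ x ∈ Ω, ContDiffAt ℝ ∞ V (ι x))
    (hVv : ∀ x ∈ Ω, V (ι x) = pushforward ι x (v x)) (hv : ∀ x ∈ Ω, SmoothFieldAt v x)
    {p : M} (hp : p ∈ Ω) (hΩ : Ω ⊆ (trivializationAt (EuclideanSpace ℝ (Fin n))
      (TangentSpace (𝓡 n) : M → Type _) p).baseSet) :
    pushforward ι p (bochner D v p) =
      -∑ i, fderiv ℝ (fderiv ℝ V) (ι p) (pushforward ι p (E i p)) (pushforward ι p (E i p))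
      + ∑ i, scalarSFF ι N p (E i p) (v p) • mvfderiv (𝓡 n) (fun y => N (ι y)) p (E i p)
      - (∑ i, scalarSFF ι N p (E i p) (E i p)) • fderiv ℝ V (ι p) (N (ι p))
      + (∑ i, (scalarSFF ι N p (E i p) (D v p (E i p))
          + mvfderiv (𝓡 n) (fun y => scalarSFF ι N y (E i y) (v y)) p (E i p)
          - scalarSFF ι N p (D (E i) p (E i p)) (v p))) • N (ι p) := by
  obtain ⟨b, hb⟩ := exists_orthonormalBasis_tangent (hF.orthonormal p hp)
  -- The Hessian with its tensorial corrections moved to the same side. `Q` depends only on the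
  -- vectors at `p`, so its trace may pass from `onb`, extended as in `divEnd`, to the frame `E`;
  -- its tangential part is the second covariant derivative of `v`.
  let Q : TangentSpace (𝓡 n) p → TangentSpace (𝓡 n) p → EuclideanSpace ℝ (Fin (n + 1)) :=
    fun u w => fderiv ℝ (fderiv ℝ V) (ι p) (pushforward ι p u) (pushforward ι p w)
      - scalarSFF ι N p w (v p) • mvfderiv (𝓡 n) (fun y => N (ι y)) p u
      + scalarSFF ι N p u w • fderiv ℝ V (ι p) (N (ι p))
  -- Projection along `N`: it discards the normal coefficient for the extended `onb`, so that this
  -- coefficient is only ever computed in the frame `E`.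
  let P : EuclideanSpace ℝ (Fin (n + 1)) →ₗ[ℝ] EuclideanSpace ℝ (Fin (n + 1)) :=
    { toFun := fun z => z - (inner ℝ (N (ι p)) z : ℝ) • N (ι p)
      map_add' := fun z z' => by rw [inner_add_right, add_smul]; abel
      map_smul' := fun a z => by
        rw [real_inner_smul_right, mul_smul, RingHom.id_apply, smul_sub] }
  have hQ : ∀ {W : Π x : M, TangentSpace (𝓡 n) x} (hW : ∀ x ∈ Ω, SmoothFieldAt W x) u,
      Q u (W p) = pushforward ι p (D (fun y => D v y (W y)) p u - D v p (D W p u))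
        + (scalarSFF ι N p u (D v p (W p))
          + mvfderiv (𝓡 n) (fun y => scalarSFF ι N y (W y) (v y)) p u
          - scalarSFF ι N p (D W p u) (v p)) • N (ι p) := by
    intro W hW u
    simp only [Q]
    rw [hF.fderiv_fderiv_pushforward hD hV hVv hv hW hp]
    abel
  have hP : ∀ (z : TangentSpace (𝓡 n) p) (a : ℝ),
      P (pushforward ι p z + a • N (ι p)) = pushforward ι p z := by
    intro z a
    simp [P, inner_add_right, real_inner_smul_right, hF.inner_normal p hp, hF.norm_normal p hp]
  have htr := sum_orthonormalBasis_eq (onb p) b (LinearMap.mk₂ ℝ Q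
    (fun u u' w => by
      simp only [Q, hF.scalarSFF_eq hp, map_add, inner_add_left, add_apply]
      module)
    (fun a u w => by
      simp only [Q, hF.scalarSFF_eq hp, map_smul, real_inner_smul_left, smul_apply]
      module)
    (fun u w w' => by
      simp only [Q, hF.scalarSFF_eq hp, map_add, inner_add_right, inner_add_left]
      module)
    (fun a u w => by
      simp only [Q, hF.scalarSFF_eq hp, map_smul, real_inner_smul_right, real_inner_smul_left]
      module))
  simp only [LinearMap.mk₂_apply, hb] at htr
  have h1 : pushforward ι p (bochner D v p) = -P (∑ k, Q (onb p k) (onb p k)) := by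
    rw [bochner, map_neg, divEnd, map_sum, map_sum]
    congr 1
    refine Finset.sum_congr rfl fun k _ => ?_
    have h := hQ (fun y hy => smoothFieldAt_extend_of_mem (hΩ hy) (onb p k)) (onb p k)
    rw [FiberBundle.extend_apply_self] at h
    rw [h, hP, covDerivEnd]
  have h2 : ∀ i, P (Q (E i p) (E i p)) = Q (E i p) (E i p) -
      (scalarSFF ι N p (E i p) (D v p (E i p))
          + mvfderiv (𝓡 n) (fun y => scalarSFF ι N y (E i y) (v y)) p (E i p)
          - scalarSFF ι N p (D (E i) p (E i p)) (v p)) • N (ι p) := by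
    intro i
    rw [hQ (hF.smooth_frame i), hP, add_sub_cancel_right]
  rw [h1, htr, map_sum]
  simp only [h2]
  rw [Finset.sum_smul, Finset.sum_smul, Finset.sum_sub_distrib]
  simp only [Q]
  rw [Finset.sum_add_distrib, Finset.sum_sub_distrib]
  abel

end IsAdaptedFrame

/-! ### The Euclidean Laplacian as a trace, and the final assembly. -/

theorem euclBochner_eq {m : ℕ} {I : Type*} [Fintype I]
    (b : OrthonormalBasis I ℝ (EuclideanSpace ℝ (Fin m)))
    {V : EuclideanSpace ℝ (Fin m) → EuclideanSpace ℝ (Fin m)} {x : EuclideanSpace ℝ (Fin m)}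
    (hV : DifferentiableAt ℝ (fderiv ℝ V) x) :
    euclBochner V x = -∑ i, fderiv ℝ (fderiv ℝ V) x (b i) (b i) := by
  have h := sum_orthonormalBasis_eq b (EuclideanSpace.basisFun (Fin m) ℝ)
    (LinearMap.mk₂ ℝ (fun u w => fderiv ℝ (fderiv ℝ V) x u w) (by simp) (by simp) (by simp)
      (by simp))
  simp only [LinearMap.mk₂_apply] at h
  rw [h, euclBochner]
  congr 1
  refine Finset.sum_congr rfl fun α _ => ?_
  have h1 : ∀ e W, euclNabla (fun _ => e) W = fun y : EuclideanSpace ℝ (Fin m) =>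
      fderiv ℝ W y e := fun e W => rfl
  simp only [h1, EuclideanSpace.basisFun_apply]
  rw [fderiv_clm_apply hV (differentiableAt_const _)]
  simp

theorem euclNabla_euclNabla {m : ℕ} {N V : EuclideanSpace ℝ (Fin m) → EuclideanSpace ℝ (Fin m)}
    {x : EuclideanSpace ℝ (Fin m)} (hV : DifferentiableAt ℝ (fderiv ℝ V) x)
    (hN : DifferentiableAt ℝ N x) :
    euclNabla N (euclNabla N V) x =
      fderiv ℝ (fderiv ℝ V) x (N x) (N x) + euclNabla (euclNabla N N) V x := by
  have h1 : ∀ Y W : EuclideanSpace ℝ (Fin m) → EuclideanSpace ℝ (Fin m),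
      euclNabla Y W = fun y => fderiv ℝ W y (Y y) := fun Y W => rfl
  simp only [h1]
  rw [fderiv_clm_apply hV hN]
  simp [add_comm]

end Hypersurface

end

theorem corollary1p2 {n : ℕ} (hn : 2 ≤ n)
    {M : Type*} [TopologicalSpace M] [ChartedSpace (EuclideanSpace ℝ (Fin n)) M]
    [IsManifold (𝓡 n) ∞ M]
    [RiemannianBundle (fun x : M => TangentSpace (𝓡 n) x)]
    [IsContMDiffRiemannianBundle (𝓡 n) ∞ (EuclideanSpace ℝ (Fin n))
      (fun x : M => TangentSpace (𝓡 n) x)]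
    -- `M` is an embedded hypersurface with the induced metric, `D` its Levi-Civita connection
    (ι : M → EuclideanSpace ℝ (Fin (n + 1)))
    (hι : IsSmoothEmbedding (𝓡 n) (𝓡 (n + 1)) ∞ ι)
    (hmetric : ∀ (x : M) (u w : TangentSpace (𝓡 n) x),
      inner ℝ u w = inner ℝ (Hypersurface.pushforward ι x u) (Hypersurface.pushforward ι x w))
    (D : CovariantDerivative (𝓡 n) (EuclideanSpace ℝ (Fin n))
      (fun x : M => TangentSpace (𝓡 n) x))
    (hD : Hypersurface.IsLeviCivita D)
    -- a smooth vector field `v` on `M`, and an extension `V` of it to a neighbourhood `U` of `p`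
    (v : Π x : M, TangentSpace (𝓡 n) x)
    (hv : ContMDiff (𝓡 n) (𝓡 n).tangent ∞ (fun x => (⟨x, v x⟩ : TangentBundle (𝓡 n) M)))
    (p : M) (U : Set (EuclideanSpace ℝ (Fin (n + 1)))) (hU : IsOpen U) (hpU : ι p ∈ U)
    (V : EuclideanSpace ℝ (Fin (n + 1)) → EuclideanSpace ℝ (Fin (n + 1)))
    (hV : ContDiffOn ℝ ∞ V U)
    (hVv : ∀ x : M, ι x ∈ U → V (ι x) = Hypersurface.pushforward ι x (v x))
    -- a smooth vector field `N` on `U` which is a unit normal along `M`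
    (N : EuclideanSpace ℝ (Fin (n + 1)) → EuclideanSpace ℝ (Fin (n + 1)))
    (hN : ContDiffOn ℝ ∞ N U)
    (hN_unit : ∀ x : M, ι x ∈ U → ‖N (ι x)‖ = 1)
    (hN_normal : ∀ x : M, ι x ∈ U → ∀ u : TangentSpace (𝓡 n) x,
      inner ℝ (N (ι x)) (Hypersurface.pushforward ι x u) = 0)
    -- a smooth orthonormal frame of `M` near `p` of eigenvectors of the shape operator
    (E : Fin n → Π x : M, TangentSpace (𝓡 n) x)
    (hE : ∀ i, ContMDiffOn (𝓡 n) (𝓡 n).tangent ∞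
      (fun x => (⟨x, E i x⟩ : TangentBundle (𝓡 n) M)) (ι ⁻¹' U))
    (hE_orth : ∀ x : M, ι x ∈ U → Orthonormal ℝ (fun i => E i x))
    (κ : Fin n → M → ℝ)
    (hκ : ∀ (i : Fin n) (x : M), ι x ∈ U →
      Hypersurface.shapeOperator ι N x (E i x) = κ i x • E i x) :
    Hypersurface.euclBochner V (ι p) =
      Hypersurface.pushforward ι p (Hypersurface.bochner D v p)
        - Hypersurface.pushforward ι p (Hypersurface.ricci D p (v p))
        + ((n : ℝ) * Hypersurface.meanCurvature ι N p) • VectorField.lieBracket ℝ N V (ι p)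
        - Hypersurface.euclNabla N (Hypersurface.euclNabla N V) (ι p)
        + Hypersurface.euclNabla (Hypersurface.euclNabla N N) V (ι p)
        - (∑ i, (Hypersurface.scalarSFF ι N p (E i p) (D v p (E i p))
            + mvfderiv (𝓡 n) (fun x => κ i x * (inner ℝ (v x) (E i x) : ℝ)) p (E i p)
            - Hypersurface.scalarSFF ι N p (D (E i) p (E i p)) (v p))) • N (ι p) := by
  -- Shrinking to the base set makes the extensions of tangent vectors at `p` smooth throughout `Ω`.
  set Ω : Set M := ι ⁻¹' U ∩ (trivializationAt (EuclideanSpace ℝ (Fin n))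
      (TangentSpace (𝓡 n) : M → Type _) p).baseSet with hΩdef
  have hιs : ContMDiff (𝓡 n) (𝓡 (n + 1)) ∞ ι := hι.contMDiff
  have hUo : IsOpen (ι ⁻¹' U) := hU.preimage hιs.continuous
  have hp : p ∈ Ω := ⟨hpU, FiberBundle.mem_baseSet_trivializationAt' p⟩
  have hVd : ∀ x ∈ Ω, ContDiffAt ℝ ∞ V (ι x) := fun x hx => hV.contDiffAt (hU.mem_nhds hx.1)
  have hNd : ∀ x ∈ Ω, ContDiffAt ℝ ∞ N (ι x) := fun x hx => hN.contDiffAt (hU.mem_nhds hx.1)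
  have hF : Hypersurface.IsAdaptedFrame ι N E Ω :=
    { isOpen := hUo.inter (trivializationAt _ _ p).open_baseSet
      contMDiff := hιs
      metric := hmetric
      contMDiffAt_normal := fun x hx => (hNd x hx).comp_contMDiffAt hιs.contMDiffAt
      norm_normal := fun x hx => hN_unit x hx.1
      inner_normal := fun x hx => hN_normal x hx.1
      smooth_frame := fun i x hx => (hE i).contMDiffAt (hUo.mem_nhds hx.1)
      orthonormal := fun x hx => hE_orth x hx.1 }
  have hvd : ∀ x ∈ Ω, Hypersurface.SmoothFieldAt v x := fun x _ => hv.contMDiffAt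
  have hVv' : ∀ x ∈ Ω, V (ι x) = Hypersurface.pushforward ι x (v x) := fun x hx => hVv x hx.1
  have hV' : DifferentiableAt ℝ (fderiv ℝ V) (ι p) :=
    ContDiffAt.differentiableAt (n := ∞) ((hVd p hp).fderiv_right (by simp)) (by simp)
  have hN' : DifferentiableAt ℝ N (ι p) := (hNd p hp).differentiableAt (by simp)
  -- Since `E i` is principal, `h(E_i,v) = g(sE_i,v) = κ^i v^i` near `p`, so the derivatives agree.
  have hprinc : ∀ i, mvfderiv (𝓡 n) (fun x => κ i x * (inner ℝ (v x) (E i x) : ℝ)) p =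
      mvfderiv (𝓡 n) (fun y => Hypersurface.scalarSFF ι N y (E i y) (v y)) p := by
    intro i
    refine Hypersurface.mvfderiv_congr ?_
    filter_upwards [hF.isOpen.mem_nhds hp] with y hy
    rw [← hF.inner_shapeOperator hy, hκ i y hy.1, real_inner_smul_left, real_inner_comm]
  have hH : (n : ℝ) * Hypersurface.meanCurvature ι N p =
      ∑ i, Hypersurface.scalarSFF ι N p (E i p) (E i p) := by
    have hn0 : (n : ℝ) ≠ 0 := by positivity
    rw [Hypersurface.meanCurvature, hF.sum_scalarSFF_onb hp]
    field_simp
  -- `V` is tangent at `ι p`, so the `∇̃_V N` half of the bracket involves `N` only along `M`.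
  have hA : fderiv ℝ N (ι p) (V (ι p)) = mvfderiv (𝓡 n) (fun y => N (ι y)) p (v p) := by
    rw [Hypersurface.mvfderiv_comp_fderiv hN' (hιs.mdifferentiableAt (by simp)), hVv p hpU]
    rfl
  obtain ⟨b, hb, hb'⟩ := hF.exists_orthonormalBasis_ambient hp
  rw [Hypersurface.euclBochner_eq b hV', Fintype.sum_option,
    hF.pushforward_bochner hD hVd hVv' hvd hp Set.inter_subset_right,
    hF.pushforward_ricci hD hp Set.inter_subset_right, hH,
    Hypersurface.euclNabla_euclNabla hV' hN', VectorField.lieBracket, hA]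
  simp only [hb, hb', hprinc]
  module
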